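/- All Banach spaces are real. For a bounded operator $T:X\to Y$ let $T^*:Y^*\to X^*$ be its adjoint, and regard $X$ as a subspace of $X^{**}$ via the canonical embedding. An operator ideal $\mathcal A$ assigns to each pair of Banach spaces $X,Y$ a linear subspace $\mathcal A(X,Y)$ of $\mathcal L(X,Y)$ that contains all finite-rank operators, such that $RTS\in\mathcal A(W,Z)$ whenever $S\in\mathcal L(W,X)$, $T\in\mathcal A(X,Y)$, $R\in\mathcal L(Y,Z)$. Put $\mathcal A^{dd}(X,Y)=\{T\in\mathcal L(X,Y): T^{**}\in\mathcal A(X^{**},Y^{**})\}$. For a Banach space $X$, $\mathrm{Lip}_0(X)$ is the Banach space of Lipschitz functions $f:X\to\mathbb R$ with $f(0)=0$, with norm $\|f\|=\sup_{x\ne y}|f(x)-f(y)|/\|x-y\|$ (and $\|f\|=0$ if $X=\{0\}$), and $\mathfrak F(X)=\overline{\mathrm{span}}\{\delta_x:x\in X\}\subseteq \mathrm{Lip}_0(X)^*$, where $\delta_x(f)=f(x)$, is the Lipschitz-free space over $X$; $\mathrm{Lip}_0(X)$ is identified with $\mathfrak F(X)^*$ by the canonical isometric isomorphism $f\mapsto(\mu\mapsto\mu(f))$.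 Let $\tau_c$ be the compact-open topology. A Banach space $Z$ has the $\mathcal A$-BAP if there is $\lambda\ge1$ such that $\mathrm{Id}_Z$ is in the $\tau_c$-closure of $\{T\in\mathcal A(Z,Z):\|T\|\le\lambda\}$. The dual $Z^*$ has the $\mathcal A$-BAP with conjugate operators if there is $\lambda\ge1$ such that $\mathrm{Id}_{Z^*}$ is in the $\tau_c$-closure of $\{T^*: T\in\mathcal A(Z,Z),\ \|T\|\le\lambda\}$. A Banach space $Z$ is strongly extendably locally reflexive if there is $\lambda\ge1$ such that for all finite-dimensional subspaces $E\subseteq Z^{**}$, $F\subseteq Z^*$ and every $\varepsilon>0$ there is $T\in\mathcal L(Z^{**},Z^{**})$ with $\|T\|\le\lambda+\varepsilon$, $T(E)\subseteq Z$, $T^*(Z^*)\subseteq Z^*$ and $(Tz^{**})(z^*)=z^{**}(z^*)$ for all $z^{**}\in E$, $z^*\in F$. Proposition. Let $\mathcal A$ be an operator ideal with $\mathcal A=\mathcal A^{dd}$, and suppose that for every Banach space $Z$ and every $T\in\mathcal A(Z,Z)$ one has $T^{**}\in\mathcal A(Z^{**},Z)$ (that is, $T^{**}$ takes its values in $Z$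 and, as an operator from $Z^{**}$ into $Z$, belongs to $\mathcal A$). Then for every Banach space $X$ the following are equivalent: (a) $\mathrm{Lip}_0(X)$ has the $\mathcal A$-BAP with conjugate operators; (b) $\mathfrak F(X)$ has the $\mathcal A$-BAP and is strongly extendably locally reflexive. -/

import Mathlib

set_option maxSynthPendingDepth 3

universe u v

noncomputable section

/-! Duals, adjoints and canonical embeddings. -/

/-- The Banach-space adjoint `T* : Y* → X*`, `T* g = g ∘ T`, of a bounded operator `T : X → Y`. -/
def conjOp {X : Type u} {Y : Type v} [NormedAddCommGroup X] [NormedSpace ℝ X]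
    [NormedAddCommGroup Y] [NormedSpace ℝ Y] (T : X →L[ℝ] Y) :
    StrongDual ℝ Y →L[ℝ] StrongDual ℝ X :=
  ContinuousLinearMap.precomp ℝ T

/-- The bidual `X**`. -/
abbrev Bidual (X : Type u) [NormedAddCommGroup X] [NormedSpace ℝ X] : Type u :=
  StrongDual ℝ (StrongDual ℝ X)

/-- The second adjoint `T** : X** → Y**`. -/
def biconjOp {X : Type u} {Y : Type v} [NormedAddCommGroup X] [NormedSpace ℝ X]
    [NormedAddCommGroup Y] [NormedSpace ℝ Y] (T : X →L[ℝ] Y) : Bidual X →L[ℝ] Bidual Y :=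
  conjOp (conjOp T)

/-- The canonical embedding `X → X**`. -/
abbrev canonEmb (X : Type u) [NormedAddCommGroup X] [NormedSpace ℝ X] : X →L[ℝ] Bidual X :=
  NormedSpace.inclusionInDoubleDual ℝ X

/-! Operator ideals. -/

/-- An operator ideal on the class of real Banach spaces: linear subspaces `A(X, Y)` of `L(X, Y)`,
containing the rank-one operators (hence all finite-rank operators) and stable under composition
with bounded operators on both sides. -/
structure OperatorIdeal where
  /-- The component `A(X, Y)`. -/
  comp : ∀ (X Y : Type u) [NormedAddCommGroup X] [NormedSpace ℝ X] [CompleteSpace X]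
    [NormedAddCommGroup Y] [NormedSpace ℝ Y] [CompleteSpace Y], Submodule ℝ (X →L[ℝ] Y)
  rankOne_mem : ∀ (X Y : Type u) [NormedAddCommGroup X] [NormedSpace ℝ X] [CompleteSpace X]
    [NormedAddCommGroup Y] [NormedSpace ℝ Y] [CompleteSpace Y] (f : StrongDual ℝ X) (y : Y),
    f.smulRight y ∈ comp X Y
  comp_mem : ∀ (W X Y Z : Type u) [NormedAddCommGroup W] [NormedSpace ℝ W] [CompleteSpace W]
    [NormedAddCommGroup X] [NormedSpace ℝ X] [CompleteSpace X]
    [NormedAddCommGroup Y] [NormedSpace ℝ Y] [CompleteSpace Y]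
    [NormedAddCommGroup Z] [NormedSpace ℝ Z] [CompleteSpace Z]
    (R : Y →L[ℝ] Z) (T : X →L[ℝ] Y) (S : W →L[ℝ] X), T ∈ comp X Y → (R ∘L T) ∘L S ∈ comp W Z

/-- `A^{dd}(X, Y) = {T ∈ L(X, Y) : T** ∈ A(X**, Y**)}`. -/
def OperatorIdeal.dd (A : OperatorIdeal.{u}) (X Y : Type u)
    [NormedAddCommGroup X] [NormedSpace ℝ X] [CompleteSpace X]
    [NormedAddCommGroup Y] [NormedSpace ℝ Y] [CompleteSpace Y] : Set (X →L[ℝ] Y) :=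
  {T | biconjOp T ∈ A.comp (Bidual X) (Bidual Y)}

/-- `A = A^{dd}`. -/
def OperatorIdeal.EqDD (A : OperatorIdeal.{u}) : Prop :=
  ∀ (X Y : Type u) [NormedAddCommGroup X] [NormedSpace ℝ X] [CompleteSpace X]
    [NormedAddCommGroup Y] [NormedSpace ℝ Y] [CompleteSpace Y],
    (A.comp X Y : Set (X →L[ℝ] Y)) = A.dd X Y

/-- For every Banach space `Z` and `T ∈ A(Z, Z)` one has `T** ∈ A(Z**, Z)`: the operator `T**`
takes its values in (the canonical copy of) `Z`, and, as an operator into `Z`, it belongs to `A`. -/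
def OperatorIdeal.BiconjIntoSpace (A : OperatorIdeal.{u}) : Prop :=
  ∀ (Z : Type u) [NormedAddCommGroup Z] [NormedSpace ℝ Z] [CompleteSpace Z] (T : Z →L[ℝ] Z),
    T ∈ A.comp Z Z → ∃ S ∈ A.comp (Bidual Z) Z, canonEmb Z ∘L S = biconjOp T

/-! Approximation properties. -/

/-- The identity of `X` lies in the closure of the set `S` of operators on `X` in the compact-open
topology (the topology of `C(X, X)`). -/
def IdMemClosure {X : Type u} [NormedAddCommGroup X] [NormedSpace ℝ X] (S : Set (X →L[ℝ] X)) :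
    Prop :=
  ContinuousMap.id X ∈ closure ((fun T : X →L[ℝ] X => (T : C(X, X))) '' S)

/-- `A^L(X, Y) = {T ∈ A(X, Y) : ‖T‖ ≤ L}`. -/
def OperatorIdeal.bdd (A : OperatorIdeal.{u}) (L : ℝ) (X Y : Type u)
    [NormedAddCommGroup X] [NormedSpace ℝ X] [CompleteSpace X]
    [NormedAddCommGroup Y] [NormedSpace ℝ Y] [CompleteSpace Y] : Set (X →L[ℝ] Y) :=
  {T | T ∈ A.comp X Y ∧ ‖T‖ ≤ L}

/-- The `A`-bounded approximation property of a Banach space `X`. -/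
def OperatorIdeal.BAP (A : OperatorIdeal.{u}) (X : Type u)
    [NormedAddCommGroup X] [NormedSpace ℝ X] [CompleteSpace X] : Prop :=
  ∃ L : ℝ, 1 ≤ L ∧ IdMemClosure (A.bdd L X X)

/-- The `A`-bounded approximation property with conjugate operators of a dual space `Y`, where `Y`
is identified with `Z*` by the isometric isomorphism `Φ`: for some `L ≥ 1` the identity of `Y` is
in the compact-open closure of the adjoints `T*`, read on `Y` through `Φ`, with `T ∈ A(Z, Z)` and
`‖T‖ ≤ L`. -/
def OperatorIdeal.ConjBAP (A : OperatorIdeal.{u}) {Y : Type v} {Z : Type u}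
    [NormedAddCommGroup Y] [NormedSpace ℝ Y]
    [NormedAddCommGroup Z] [NormedSpace ℝ Z] [CompleteSpace Z]
    (Φ : Y ≃ₗᵢ[ℝ] StrongDual ℝ Z) : Prop :=
  ∃ L : ℝ, 1 ≤ L ∧ IdMemClosure
    {V : Y →L[ℝ] Y | ∃ T ∈ A.bdd L Z Z, ∀ y : Y, Φ (V y) = conjOp T (Φ y)}

/-- Strong extendable local reflexivity of a Banach space `X`. -/
def StronglyExtLocReflexive (X : Type u) [NormedAddCommGroup X] [NormedSpace ℝ X] : Prop :=
  ∃ L : ℝ, 1 ≤ L ∧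
    ∀ (E : Submodule ℝ (Bidual X)) (F : Submodule ℝ (StrongDual ℝ X)),
      FiniteDimensional ℝ E → FiniteDimensional ℝ F → ∀ ε : ℝ, 0 < ε →
        ∃ T : Bidual X →L[ℝ] Bidual X, ‖T‖ ≤ L + ε ∧
          (∀ e ∈ E, T e ∈ Set.range (canonEmb X)) ∧
          (∀ f : StrongDual ℝ X,
            conjOp T (canonEmb (StrongDual ℝ X) f) ∈ Set.range (canonEmb (StrongDual ℝ X))) ∧
          ∀ e ∈ E, ∀ f ∈ F, T e f = e f

/-! The space `Lip₀(X)` of real Lipschitz functions vanishing at `0`. -/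

/-- The linear space of Lipschitz functions `f : X → ℝ` with `f 0 = 0`. -/
def lip0Submodule (X : Type u) [NormedAddCommGroup X] : Submodule ℝ (X → ℝ) where
  carrier := {f | (∃ K : ℝ, ∀ x y, |f x - f y| ≤ K * ‖x - y‖) ∧ f 0 = 0}
  add_mem' := by
    rintro f g ⟨⟨K, hK⟩, hf⟩ ⟨⟨M, hM⟩, hg⟩
    refine ⟨⟨K + M, fun x y => ?_⟩, by simp [hf, hg]⟩
    have h := abs_add_le (f x - f y) (g x - g y)
    have e : (f + g) x - (f + g) y = (f x - f y) + (g x - g y) := by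
      simp only [Pi.add_apply]; ring
    rw [e]
    linarith [hK x y, hM x y]
  zero_mem' := ⟨⟨0, fun x y => by simp⟩, rfl⟩
  smul_mem' := by
    rintro c f ⟨⟨K, hK⟩, hf⟩
    refine ⟨⟨|c| * K, fun x y => ?_⟩, by simp [hf]⟩
    have e : (c • f) x - (c • f) y = c * (f x - f y) := by
      simp only [Pi.smul_apply, smul_eq_mul]; ring
    rw [e, abs_mul, mul_assoc]
    exact mul_le_mul_of_nonneg_left (hK x y) (abs_nonneg c)

/-- The space `Lip₀(X)`, with the Lipschitz norm defined below. -/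
def Lip0 (X : Type u) [NormedAddCommGroup X] : Type u := lip0Submodule X

namespace Lip0

variable {X : Type u} [NormedAddCommGroup X]

instance : AddCommGroup (Lip0 X) := inferInstanceAs (AddCommGroup (lip0Submodule X))

instance : Module ℝ (Lip0 X) := inferInstanceAs (Module ℝ (lip0Submodule X))

instance : FunLike (Lip0 X) X ℝ where
  coe f := f.1
  coe_injective := Subtype.coe_injective

@[ext] theorem ext {f g : Lip0 X} (h : ∀ x, f x = g x) : f = g := DFunLike.ext _ _ h

theorem map_zero (f : Lip0 X) : f 0 = 0 := f.2.2

@[simp] theorem zero_apply (x : X) : (0 : Lip0 X) x = 0 := rfl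

@[simp] theorem add_apply (f g : Lip0 X) (x : X) : (f + g) x = f x + g x := rfl

@[simp] theorem smul_apply (c : ℝ) (f : Lip0 X) (x : X) : (c • f) x = c * f x := rfl

/-- `‖f‖ = sup {|f x - f y| / ‖x - y‖ : x ≠ y}`; pairs with `x = y` contribute the value `0`. -/
instance : Norm (Lip0 X) := ⟨fun f => ⨆ p : X × X, |f p.1 - f p.2| / ‖p.1 - p.2‖⟩

theorem norm_def (f : Lip0 X) : ‖f‖ = ⨆ p : X × X, |f p.1 - f p.2| / ‖p.1 - p.2‖ := rfl

theorem norm_le_of {f : Lip0 X} {K : ℝ} (hK : 0 ≤ K) (h : ∀ x y, |f x - f y| ≤ K * ‖x - y‖) :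
    ‖f‖ ≤ K :=
  ciSup_le fun p => div_le_of_le_mul₀ (norm_nonneg _) hK (h p.1 p.2)

theorem bddAbove (f : Lip0 X) :
    BddAbove (Set.range fun p : X × X => |f p.1 - f p.2| / ‖p.1 - p.2‖) := by
  obtain ⟨K, hK⟩ := f.2.1
  refine ⟨|K|, ?_⟩
  rintro _ ⟨p, rfl⟩
  refine div_le_of_le_mul₀ (norm_nonneg _) (abs_nonneg K) ((hK p.1 p.2).trans ?_)
  exact mul_le_mul_of_nonneg_right (le_abs_self K) (norm_nonneg _)

theorem abs_sub_le (f : Lip0 X) (x y : X) : |f x - f y| ≤ ‖f‖ * ‖x - y‖ := by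
  rcases eq_or_ne x y with rfl | hxy
  · simp
  · have h : 0 < ‖x - y‖ := norm_pos_iff.2 (sub_ne_zero.2 hxy)
    rw [← div_le_iff₀ h]
    exact le_ciSup (bddAbove f) (x, y)

theorem norm_nonneg' (f : Lip0 X) : 0 ≤ ‖f‖ :=
  Real.iSup_nonneg fun _ => div_nonneg (abs_nonneg _) (norm_nonneg _)

theorem norm_smul_le' (c : ℝ) (f : Lip0 X) : ‖c • f‖ ≤ |c| * ‖f‖ := by
  refine norm_le_of (mul_nonneg (abs_nonneg c) (norm_nonneg' f)) fun x y => ?_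
  rw [smul_apply, smul_apply, ← mul_sub, abs_mul, mul_assoc]
  exact mul_le_mul_of_nonneg_left (abs_sub_le f x y) (abs_nonneg c)

theorem core : NormedSpace.Core ℝ (Lip0 X) where
  norm_nonneg := norm_nonneg'
  norm_smul c f := by
    rw [Real.norm_eq_abs]
    refine le_antisymm (norm_smul_le' c f) ?_
    rcases eq_or_ne c 0 with rfl | hc
    · simpa using norm_nonneg' _
    · have h := norm_smul_le' c⁻¹ (c • f)
      rw [smul_smul, inv_mul_cancel₀ hc, one_smul, abs_inv] at h
      rwa [le_inv_mul_iff₀ (abs_pos.2 hc)] at h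
  norm_triangle f g := by
    refine norm_le_of (add_nonneg (norm_nonneg' f) (norm_nonneg' g)) fun x y => ?_
    have e : (f + g) x - (f + g) y = (f x - f y) + (g x - g y) := by
      simp only [add_apply]; ring
    rw [e]
    linarith [abs_add_le (f x - f y) (g x - g y), abs_sub_le f x y, abs_sub_le g x y]
  norm_eq_zero_iff f := by
    constructor
    · intro h
      ext x
      have := abs_sub_le f x 0
      rw [h, zero_mul, map_zero, sub_zero] at this
      simpa using this
    · rintro rfl
      exact le_antisymm (norm_le_of le_rfl fun x y => by simp) (norm_nonneg' _)

instance : NormedAddCommGroup (Lip0 X) := NormedAddCommGroup.ofCore core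

instance : NormedSpace ℝ (Lip0 X) := NormedSpace.ofCore core

/-- The evaluation functional `δ_x ∈ Lip₀(X)*`, `δ_x f = f x`. -/
def eval (x : X) : StrongDual ℝ (Lip0 X) :=
  LinearMap.mkContinuous
    { toFun := fun f : Lip0 X => f x
      map_add' := fun _ _ => rfl
      map_smul' := fun _ _ => rfl } ‖x‖ fun f => by
    have h := abs_sub_le f x 0
    rw [map_zero, sub_zero, sub_zero] at h
    rw [mul_comm]
    exact h

@[simp] theorem eval_apply (x : X) (f : Lip0 X) : eval x f = f x := rfl

end Lip0

/-! The Lipschitz-free space. -/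

/-- `span {δ_x : x ∈ X}`, closed in norm, as a subspace of `Lip₀(X)*`. -/
def freeSubmodule (X : Type u) [NormedAddCommGroup X] : Submodule ℝ (StrongDual ℝ (Lip0 X)) :=
  (Submodule.span ℝ (Set.range (Lip0.eval (X := X)))).topologicalClosure

/-- The Lipschitz-free space over `X`, with the norm of `Lip₀(X)*`. -/
abbrev LipFree (X : Type u) [NormedAddCommGroup X] : Type u := freeSubmodule X

instance (X : Type u) [NormedAddCommGroup X] : CompleteSpace (LipFree X) :=
  (Submodule.isClosed_topologicalClosure _).completeSpace_coe

namespace LipFree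

variable {X : Type u} [NormedAddCommGroup X]

/-- The map `δ_X` from `X` into its Lipschitz-free space. -/
def delta (x : X) : LipFree X :=
  ⟨Lip0.eval x, Submodule.le_topologicalClosure _ (Submodule.subset_span ⟨x, rfl⟩)⟩

theorem norm_delta_sub_le (x y : X) : ‖delta x - delta y‖ ≤ ‖x - y‖ := by
  refine ContinuousLinearMap.opNorm_le_bound (Lip0.eval x - Lip0.eval y) (norm_nonneg _)
    fun f => ?_
  rw [mul_comm]
  exact Lip0.abs_sub_le f x y

/-- The canonical pairing `Lip₀(X) → F(X)*`, `f ↦ (μ ↦ μ f)`. -/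
def pairing (X : Type u) [NormedAddCommGroup X] : Lip0 X →L[ℝ] StrongDual ℝ (LipFree X) :=
  conjOp (freeSubmodule X).subtypeL ∘L NormedSpace.inclusionInDoubleDual ℝ (Lip0 X)

theorem pairing_apply (f : Lip0 X) (μ : LipFree X) :
    pairing X f μ = (μ : StrongDual ℝ (Lip0 X)) f := rfl

theorem pairing_delta (f : Lip0 X) (x : X) : pairing X f (delta x) = f x := rfl

theorem norm_pairing (f : Lip0 X) : ‖pairing X f‖ = ‖f‖ := by
  refine le_antisymm ?_ ?_
  · refine ContinuousLinearMap.opNorm_le_bound _ (norm_nonneg _) fun μ => ?_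
    rw [pairing_apply, mul_comm]
    exact (μ : StrongDual ℝ (Lip0 X)).le_opNorm f
  · refine Lip0.norm_le_of (norm_nonneg _) fun x y => ?_
    rw [← pairing_delta f x, ← pairing_delta f y, ← map_sub, ← Real.norm_eq_abs]
    exact ((pairing X f).le_opNorm _).trans
      (mul_le_mul_of_nonneg_left (norm_delta_sub_le x y) (norm_nonneg _))

theorem dual_ext {φ ψ : StrongDual ℝ (LipFree X)} (h : ∀ x, φ (delta x) = ψ (delta x)) :
    φ = ψ := by
  have key : ∀ (a : StrongDual ℝ (Lip0 X)) (ha : a ∈ freeSubmodule X), φ ⟨a, ha⟩ = ψ ⟨a, ha⟩ := by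
    obtain ⟨φ', hφ, -⟩ := exists_extension_norm_eq (freeSubmodule X) φ
    obtain ⟨ψ', hψ, -⟩ := exists_extension_norm_eq (freeSubmodule X) ψ
    have hs : Set.EqOn φ' ψ' (Submodule.span ℝ (Set.range (Lip0.eval (X := X)))) := by
      intro a ha
      refine LinearMap.eqOn_span (f := φ'.toLinearMap) (g := ψ'.toLinearMap) ?_ ha
      rintro _ ⟨x, rfl⟩
      exact ((hφ (delta x)).trans (h x)).trans (hψ (delta x)).symm
    intro a ha
    have h1 := hs.closure φ'.continuous ψ'.continuous ha
    exact ((hφ ⟨a, ha⟩).symm.trans h1).trans (hψ ⟨a, ha⟩)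
  ext μ
  exact key μ.1 μ.2

theorem pairing_surjective : Function.Surjective (pairing X) := by
  intro φ
  have h0 : delta (0 : X) = 0 := by
    apply Subtype.ext
    ext f
    exact Lip0.map_zero f
  refine ⟨⟨fun x => φ (delta x), ⟨‖φ‖, fun x y => ?_⟩, ?_⟩, dual_ext fun x => rfl⟩
  · rw [← map_sub, ← Real.norm_eq_abs]
    exact (φ.le_opNorm _).trans
      (mul_le_mul_of_nonneg_left (norm_delta_sub_le x y) (norm_nonneg _))
  · exact (congrArg φ h0).trans (map_zero φ)

/-- The canonical isometric isomorphism of `Lip₀(X)` onto `F(X)*`. -/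
def dualEquiv (X : Type u) [NormedAddCommGroup X] :
    Lip0 X ≃ₗᵢ[ℝ] StrongDual ℝ (LipFree X) :=
  LinearIsometryEquiv.ofSurjective ⟨(pairing X).toLinearMap, norm_pairing⟩ pairing_surjective

theorem dualEquiv_apply (f : Lip0 X) (μ : LipFree X) :
    dualEquiv X f μ = (μ : StrongDual ℝ (Lip0 X)) f := rfl

end LipFree

end

/-! Approximation of the identity on finite sets. -/

/-! The result is about a Banach space `Z` and its dual; Lipschitz functions enter only through the
isometry `Lip₀(X) ≅ F(X)*`. On bounded sets of operators, compact-open approximation amounts to norm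
approximation on finite sets, and for convex sets weak approximation already suffices
(`exists_norm_lt_of_convex`, by Hahn–Banach). So (a) becomes `DualApprox`. From (a), `T*` near the
identity makes `T` weakly near the identity, whence the BAP. Moreover a small finite-rank
perturbation gives `T* = Id` on a prescribed finite-dimensional `F ⊆ Z*`; since `T**` maps `Z**`
into `Z`, it witnesses strong extendable local reflexivity. Conversely, let `V` on `Z**` come from
local reflexivity and `T` from the BAP. Then `R = T** V|_Z` lies in `A(Z, Z)` and `R* f = V*(T* f) ∈
Z*`, so `φ(R* f) = f(T(Vφ))`, which is close to `f(Vφ) = φ(f)`. Thus `R*` is weakly near the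
identity, and convexity finishes. -/

theorem IdMemClosure.exists_norm_lt {X : Type u} [NormedAddCommGroup X] [NormedSpace ℝ X]
    {S : Set (X →L[ℝ] X)} (h : IdMemClosure S) (s : Finset X) {ε : ℝ} (hε : 0 < ε) :
    ∃ T ∈ S, ∀ x ∈ s, ‖T x - x‖ < ε := by
  have hbasis := nhds_basis_uniformity' (x := ContinuousMap.id X)
    ContinuousMap.hasBasis_compactConvergenceUniformity
  obtain ⟨_, ⟨T, hT, rfl⟩, hx⟩ := ((mem_closure_iff_nhds_basis hbasis).1 h)
    ((s : Set X), {p | dist p.1 p.2 < ε}) ⟨s.finite_toSet.isCompact, Metric.dist_mem_uniformity hε⟩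
  refine ⟨T, hT, fun x hxs => ?_⟩
  have h1 : dist x (T x) < ε := hx x hxs
  rwa [dist_comm, dist_eq_norm] at h1

/-- A bounded set of operators that approximates the identity on finite sets approximates it in the
compact-open topology. -/
theorem idMemClosure_of_forall_finset {X : Type u} [NormedAddCommGroup X] [NormedSpace ℝ X]
    {S : Set (X →L[ℝ] X)} {L : ℝ} (hS : ∀ T ∈ S, ‖T‖ ≤ L)
    (h : ∀ (s : Finset X) (ε : ℝ), 0 < ε → ∃ T ∈ S, ∀ x ∈ s, ‖T x - x‖ < ε) :
    IdMemClosure S := by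
  have hL : 0 ≤ L := by
    obtain ⟨T, hT, -⟩ := h ∅ 1 one_pos
    exact (norm_nonneg T).trans (hS T hT)
  have hbasis := nhds_basis_uniformity' (x := ContinuousMap.id X)
    ContinuousMap.hasBasis_compactConvergenceUniformity
  refine (mem_closure_iff_nhds_basis hbasis).2 ?_
  rintro ⟨K, U⟩ ⟨hK, hU⟩
  obtain ⟨ε, hε, hεU⟩ := Metric.mem_uniformity_dist.1 hU
  -- With `η = ε / (L + 2)`, the terms `x - y`, `T (x - y)` and `T y - y` contribute at most `η`, `L
  -- η` and `η`, adding up to `ε`.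
  have hη : 0 < ε / (L + 2) := by positivity
  obtain ⟨t, -, ht, hcov⟩ := hK.finite_cover_balls hη
  obtain ⟨T, hT, hTx⟩ := h ht.toFinset _ hη
  refine ⟨_, ⟨T, hT, rfl⟩, fun x hx => hεU ?_⟩
  change dist x (T x) < ε
  obtain ⟨y, hy, hxy⟩ := Set.mem_iUnion₂.1 (hcov hx)
  rw [Metric.mem_ball, dist_eq_norm] at hxy
  have h1 := hTx y (ht.mem_toFinset.2 hy)
  have h2 : ‖T (x - y)‖ ≤ L * (ε / (L + 2)) := (T.le_of_opNorm_le (hS T hT) _).trans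
    (mul_le_mul_of_nonneg_left hxy.le hL)
  have e : x - T x = (x - y) - T (x - y) - (T y - y) := by rw [map_sub]; abel
  rw [dist_eq_norm, e]
  have h3 := norm_sub_le ((x - y) - T (x - y)) (T y - y)
  have h4 := norm_sub_le (x - y) (T (x - y))
  have h5 : L * (ε / (L + 2)) + 2 * (ε / (L + 2)) = ε := by field_simp
  linarith

/-- For a convex set of operators, weak approximation of the identity on finite sets implies norm
approximation. -/
theorem exists_norm_lt_of_convex {X : Type u} [NormedAddCommGroup X] [NormedSpace ℝ X]
    {S : Set (X →L[ℝ] X)} (hS : Convex ℝ S)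
    (h : ∀ (s : Finset X) (φ : X → StrongDual ℝ X) (ε : ℝ), 0 < ε →
      ∃ T ∈ S, ∀ x ∈ s, |φ x (T x) - φ x x| < ε)
    (s : Finset X) (ε : ℝ) (hε : 0 < ε) : ∃ T ∈ S, ∀ x ∈ s, ‖T x - x‖ < ε := by
  classical
  let ev : (X →L[ℝ] X) →ₗ[ℝ] (s → X) :=
    { toFun := fun T x => T x
      map_add' := fun _ _ => rfl
      map_smul' := fun _ _ => rfl }
  let p : s → X := fun x => x
  have hp : p ∈ closure (ev '' S) := by
    by_contra hp
    obtain ⟨g, c, hg, hgp⟩ := geometric_hahn_banach_closed_point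
      (hS.linear_image ev).closure isClosed_closure hp
    -- A functional separating `p` from the image is a sum of coordinate functionals; these are the
    -- test functionals fed to `h`.
    let φ : X → StrongDual ℝ X := fun x =>
      if hx : x ∈ s then g ∘L ContinuousLinearMap.single ℝ (fun _ : s => X) ⟨x, hx⟩ else 0
    have hφ : ∀ w : s → X, g w = ∑ x : s, φ x (w x) := by
      intro w
      conv_lhs => rw [← Finset.univ_sum_single w]
      rw [map_sum]
      refine Finset.sum_congr rfl fun x _ => ?_
      simp [φ]
    -- The gap is shared among the points of `s`; the `+ 1` covers empty `s`.
    have hd : 0 < (g p - c) / (s.card + 1) := div_pos (sub_pos.2 hgp) (by positivity)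
    obtain ⟨T, hT, hTx⟩ := h s φ _ hd
    have h1 := hg (ev T) (subset_closure ⟨T, hT, rfl⟩)
    have h2 : g p - g (ev T) ≤ ∑ _x : s, (g p - c) / (s.card + 1) := by
      have e : g p - g (ev T) = ∑ x : s, (φ x (p x) - φ x (ev T x)) := by
        rw [Finset.sum_sub_distrib, ← hφ, ← hφ]
      rw [e]
      refine Finset.sum_le_sum fun x _ => ?_
      have := abs_lt.1 (hTx x x.2)
      change φ x x - φ x (T x) ≤ _
      linarith [this.1]
    rw [Finset.sum_const, Finset.card_univ, Fintype.card_coe, nsmul_eq_mul] at h2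
    have h3 : ((s.card : ℝ) + 1) * ((g p - c) / (s.card + 1)) = g p - c := by field_simp
    nlinarith
  obtain ⟨_, ⟨T, hT, rfl⟩, hd⟩ := Metric.mem_closure_iff.1 hp ε hε
  refine ⟨T, hT, fun x hx => ?_⟩
  have := (dist_pi_lt_iff hε).1 hd ⟨x, hx⟩
  rwa [dist_comm, dist_eq_norm] at this

/-! Adjoints. -/

section Adjoint

variable {X : Type u} {Y : Type v} [NormedAddCommGroup X] [NormedSpace ℝ X]
  [NormedAddCommGroup Y] [NormedSpace ℝ Y]

theorem conjOp_apply (T : X →L[ℝ] Y) (g : StrongDual ℝ Y) (x : X) : conjOp T g x = g (T x) := rfl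

theorem norm_conjOp_le (T : X →L[ℝ] Y) : ‖conjOp T‖ ≤ ‖T‖ :=
  ContinuousLinearMap.opNorm_le_bound _ (norm_nonneg _) fun g => by
    rw [mul_comm]
    exact g.opNorm_comp_le T

theorem norm_biconjOp_le (T : X →L[ℝ] Y) : ‖biconjOp T‖ ≤ ‖T‖ :=
  (norm_conjOp_le _).trans (norm_conjOp_le T)

/-- The adjoint as a linear map on operators. -/
noncomputable def conjOpLinear (X : Type u) (Y : Type v) [NormedAddCommGroup X] [NormedSpace ℝ X]
    [NormedAddCommGroup Y] [NormedSpace ℝ Y] :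
    (X →L[ℝ] Y) →ₗ[ℝ] (StrongDual ℝ Y →L[ℝ] StrongDual ℝ X) where
  toFun := conjOp
  map_add' S T := by
    ext g x
    exact map_add g (S x) (T x)
  map_smul' c T := by
    ext g x
    exact map_smul g c (T x)

theorem norm_canonEmb (x : X) : ‖canonEmb X x‖ = ‖x‖ :=
  (NormedSpace.inclusionInDoubleDualLi ℝ (E := X)).norm_map x

end Adjoint

/-- A basis of a finite-dimensional space of functionals has a biorthogonal family of vectors. -/
theorem exists_biorthogonal {X : Type u} [NormedAddCommGroup X] [NormedSpace ℝ X]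
    (F : Submodule ℝ (StrongDual ℝ X)) [FiniteDimensional ℝ F] {ι : Type*}
    (b : Module.Basis ι ℝ F) :
    ∃ z : ι → X, ∀ (f : F) (i : ι), (f : StrongDual ℝ X) (z i) = b.repr f i := by
  let B : F →ₗ[ℝ] X →ₗ[ℝ] ℝ :=
    { toFun := fun f => (f : StrongDual ℝ X).toLinearMap
      map_add' := fun _ _ => rfl
      map_smul' := fun _ _ => rfl }
  have hB : Function.Injective B := fun f g h =>
    Subtype.ext (ContinuousLinearMap.ext fun x => LinearMap.congr_fun h x)
  -- As `F` is finite-dimensional and `X` separates its elements, every functional on `F` is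
  -- evaluation at a vector of `X`.
  have hs := LinearMap.flip_surjective_iff₁.2 hB
  choose z hz using fun i => hs (b.coord i)
  exact ⟨z, fun f i => LinearMap.congr_fun (hz i) f⟩

/-! The bounded approximation property of a Banach space and of its dual. -/

section Duality

variable (A : OperatorIdeal.{u}) (Z : Type u) [NormedAddCommGroup Z] [NormedSpace ℝ Z]
  [CompleteSpace Z]

theorem OperatorIdeal.convex_bdd (L : ℝ) : Convex ℝ (A.bdd L Z Z) := by
  have e : A.bdd L Z Z = (A.comp Z Z : Set (Z →L[ℝ] Z)) ∩ Metric.closedBall 0 L := by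
    ext T
    simp [OperatorIdeal.bdd]
  rw [e]
  exact (A.comp Z Z).convex.inter (convex_closedBall _ _)

/-- The adjoints of operators in `A(Z, Z)` approximate the identity of `Z*` boundedly. -/
def OperatorIdeal.DualApprox : Prop :=
  ∃ L : ℝ, 1 ≤ L ∧ ∀ (s : Finset (StrongDual ℝ Z)) (ε : ℝ), 0 < ε →
    ∃ T ∈ A.bdd L Z Z, ∀ f ∈ s, ‖conjOp T f - f‖ < ε

variable {Z}

theorem OperatorIdeal.conjBAP_iff_dualApprox {Y : Type v} [NormedAddCommGroup Y] [NormedSpace ℝ Y]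
    (Φ : Y ≃ₗᵢ[ℝ] StrongDual ℝ Z) : A.ConjBAP Φ ↔ A.DualApprox Z := by
  classical
  constructor
  · rintro ⟨L, hL, h⟩
    refine ⟨L, hL, fun s ε hε => ?_⟩
    obtain ⟨V, ⟨T, hT, hV⟩, hVs⟩ := h.exists_norm_lt (s.image Φ.symm) hε
    refine ⟨T, hT, fun f hf => ?_⟩
    have h1 := hVs (Φ.symm f) (Finset.mem_image_of_mem _ hf)
    have h2 := hV (Φ.symm f)
    rw [← Φ.norm_map, map_sub, h2] at h1
    simpa using h1
  · rintro ⟨L, hL, h⟩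
    refine ⟨L, hL, idMemClosure_of_forall_finset (L := L) ?_ fun s ε hε => ?_⟩
    · rintro V ⟨T, hT, hV⟩
      refine V.opNorm_le_bound (zero_le_one.trans hL) fun y => ?_
      rw [← Φ.norm_map, hV y, ← Φ.norm_map y]
      exact (conjOp T).le_of_opNorm_le ((norm_conjOp_le T).trans hT.2) _
    · obtain ⟨T, hT, hTs⟩ := h (s.image Φ) ε hε
      let V : Y →L[ℝ] Y := (Φ.symm.toContinuousLinearEquiv : StrongDual ℝ Z →L[ℝ] Y) ∘L
        conjOp T ∘L (Φ.toContinuousLinearEquiv : Y →L[ℝ] StrongDual ℝ Z)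
      have hV : ∀ y, Φ (V y) = conjOp T (Φ y) := fun y => Φ.apply_symm_apply _
      refine ⟨V, ⟨T, hT, hV⟩, fun y hy => ?_⟩
      rw [← Φ.norm_map, map_sub, hV]
      exact hTs _ (Finset.mem_image_of_mem _ hy)

variable {A}

/-- Since `φ(T x) - φ(x) = (T* φ - φ)(x)`, norm approximation by adjoints gives weak approximation
by the operators themselves, which convexity upgrades to norm approximation. -/
theorem OperatorIdeal.DualApprox.bap (h : A.DualApprox Z) : A.BAP Z := by
  classical
  obtain ⟨L, hL, h⟩ := h
  refine ⟨L, hL, idMemClosure_of_forall_finset (fun T hT => hT.2)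
    (exists_norm_lt_of_convex (A.convex_bdd Z L) fun s φ ε hε => ?_)⟩
  have hM : 0 < 1 + ∑ x ∈ s, ‖x‖ := by positivity
  obtain ⟨T, hT, hTs⟩ := h (s.image φ) _ (div_pos hε hM)
  refine ⟨T, hT, fun x hx => ?_⟩
  have h1 := hTs (φ x) (Finset.mem_image_of_mem _ hx)
  have h2 := (conjOp T (φ x) - φ x).le_opNorm x
  have h3 : ‖x‖ < 1 + ∑ x ∈ s, ‖x‖ := by
    linarith [Finset.single_le_sum (f := fun x => ‖x‖) (fun y _ => norm_nonneg y) hx]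
  calc |φ x (T x) - φ x x| ≤ ‖conjOp T (φ x) - φ x‖ * ‖x‖ := h2
    _ ≤ ε / (1 + ∑ x ∈ s, ‖x‖) * ‖x‖ := by gcongr
    _ < ε / (1 + ∑ x ∈ s, ‖x‖) * (1 + ∑ x ∈ s, ‖x‖) :=
        mul_lt_mul_of_pos_left h3 (div_pos hε hM)
    _ = ε := div_mul_cancel₀ _ hM.ne'

/-- A finite-rank perturbation makes the adjoint exact on a given finite-dimensional subspace. -/
theorem OperatorIdeal.DualApprox.exists_conjOp_eq (h : A.DualApprox Z) :
    ∃ L : ℝ, 1 ≤ L ∧ ∀ F : Submodule ℝ (StrongDual ℝ Z), FiniteDimensional ℝ F →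
      ∀ ε : ℝ, 0 < ε → ∃ T ∈ A.comp Z Z, ‖T‖ ≤ L + ε ∧ ∀ f ∈ F, conjOp T f = f := by
  classical
  obtain ⟨L, hL, h⟩ := h
  refine ⟨L, hL, fun F _ ε hε => ?_⟩
  let b := Module.finBasis ℝ F
  obtain ⟨z, hz⟩ := exists_biorthogonal F b
  have hM : 0 < 1 + ∑ i, ‖z i‖ := by positivity
  obtain ⟨T, hT, hTs⟩ := h (Finset.univ.image fun i => (b i : StrongDual ℝ Z)) _ (div_pos hε hM)
  let d : Fin (Module.finrank ℝ F) → StrongDual ℝ Z := fun i => b i - conjOp T (b i)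
  have hd : ∀ i, ‖d i‖ ≤ ε / (1 + ∑ i, ‖z i‖) := fun i => by
    rw [norm_sub_rev]
    exact (hTs _ (Finset.mem_image_of_mem _ (Finset.mem_univ i))).le
  -- By biorthogonality, `S* f = ∑ f(z i) d i = f - T* f` on `F`, so `T + S` has the exact adjoint;
  -- the tolerance for `T` was chosen to force `‖S‖ ≤ ε`.
  let S : Z →L[ℝ] Z := ∑ i, (d i).smulRight (z i)
  have hS : ‖S‖ ≤ ε := by
    calc ‖S‖ ≤ ∑ i, ‖(d i).smulRight (z i)‖ := norm_sum_le _ _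
      _ ≤ ∑ i, ε / (1 + ∑ i, ‖z i‖) * ‖z i‖ := by
          refine Finset.sum_le_sum fun i _ => ?_
          rw [ContinuousLinearMap.norm_smulRight_apply]
          gcongr
          exact hd i
      _ = ε / (1 + ∑ i, ‖z i‖) * ∑ i, ‖z i‖ := by rw [Finset.mul_sum]
      _ ≤ ε / (1 + ∑ i, ‖z i‖) * (1 + ∑ i, ‖z i‖) := by gcongr; linarith
      _ = ε := div_mul_cancel₀ _ hM.ne'
  refine ⟨T + S, (A.comp Z Z).add_mem hT.1
    ((A.comp Z Z).sum_mem fun i _ => A.rankOne_mem Z Z (d i) (z i)),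
    (norm_add_le _ _).trans (add_le_add hT.2 hS), fun f hf => ?_⟩
  have hf' : f = ∑ i, b.repr ⟨f, hf⟩ i • (b i : StrongDual ℝ Z) := by
    have := congrArg (Subtype.val) (b.sum_repr ⟨f, hf⟩)
    rw [Submodule.coe_sum] at this
    exact this.symm
  have hSf : conjOp S f = f - conjOp T f := by
    have h1 : conjOp S f = ∑ i, b.repr ⟨f, hf⟩ i • d i := by
      ext x
      rw [conjOp_apply, sum_apply, map_sum, sum_apply]
      refine Finset.sum_congr rfl fun i _ => ?_
      have h2 : f (z i) = b.repr ⟨f, hf⟩ i := hz ⟨f, hf⟩ i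
      simp [h2, mul_comm]
    rw [h1]
    conv_rhs => rw [hf', map_sum, ← Finset.sum_sub_distrib]
    refine Finset.sum_congr rfl fun i _ => ?_
    rw [map_smul, ← smul_sub]
  have hadd : conjOp (T + S) f = conjOp T f + conjOp S f :=
    DFunLike.congr_fun ((conjOpLinear Z Z).map_add T S) f
  rw [hadd, hSf, add_sub_cancel]

/-- The witness is `T**` with `T* = Id` on `F`: it sends all of `Z**` into `Z`, not only `E`, and
its adjoint sends `f ∈ Z*` to `T* f ∈ Z*`. -/
theorem OperatorIdeal.DualApprox.stronglyExtLocReflexive (hbi : A.BiconjIntoSpace)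
    (h : A.DualApprox Z) : StronglyExtLocReflexive Z := by
  obtain ⟨L, hL, h⟩ := h.exists_conjOp_eq
  refine ⟨L, hL, fun E F _ hF ε hε => ?_⟩
  obtain ⟨T, hT, hTL, hTF⟩ := h F hF ε hε
  obtain ⟨S, -, hS⟩ := hbi Z T hT
  refine ⟨biconjOp T, (norm_biconjOp_le T).trans hTL, fun e _ => ⟨S e, DFunLike.congr_fun hS e⟩,
    fun f => ⟨conjOp T f, rfl⟩, fun e _ f hf => ?_⟩
  change e (conjOp T f) = e f
  rw [hTF f hf]

/-- Local reflexivity turns a weak test by `φ ∈ Z**` into a test by the vector `Vφ ∈ Z`, where the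
BAP applies. Weak approximation is enough because the set of adjoints of a convex set is convex. -/
theorem OperatorIdeal.BAP.dualApprox (hbi : A.BiconjIntoSpace) (hA : A.BAP Z)
    (hZ : StronglyExtLocReflexive Z) : A.DualApprox Z := by
  classical
  obtain ⟨L, hL, h⟩ := hA
  obtain ⟨M, hM, hZ⟩ := hZ
  refine ⟨L * (M + 1), by nlinarith, fun s ε hε => ?_⟩
  suffices H : ∃ W ∈ conjOpLinear Z Z '' A.bdd (L * (M + 1)) Z Z,
      ∀ f ∈ s, ‖W f - f‖ < ε by
    obtain ⟨_, ⟨R, hR, rfl⟩, hRs⟩ := H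
    exact ⟨R, hR, hRs⟩
  refine exists_norm_lt_of_convex ((A.convex_bdd Z _).linear_image _) (fun s φ ε hε => ?_) s ε hε
  -- Only a uniform norm bound on `V` is needed, so the slack is `1`; this is the source of the
  -- constant `L * (M + 1)`.
  obtain ⟨V, hVM, hVE, hVw, hVF⟩ := hZ (Submodule.span ℝ (s.image φ)) (Submodule.span ℝ s)
    inferInstance inferInstance 1 one_pos
  have hφ : ∀ f ∈ s, φ f ∈ Submodule.span ℝ ((s.image φ : Finset _) : Set (Bidual Z)) :=
    fun f hf => Submodule.subset_span (Finset.mem_image_of_mem φ hf)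
  choose z hz using fun f : s => hVE (φ f) (hφ f f.2)
  have hK : 0 < 1 + ∑ f ∈ s, ‖f‖ := by positivity
  obtain ⟨T, hT, hTz⟩ := h.exists_norm_lt (Finset.univ.image z) (div_pos hε hK)
  obtain ⟨S, hS, hST⟩ := hbi Z T hT.1
  have hSn : ‖S‖ ≤ L := S.opNorm_le_bound (zero_le_one.trans hL) fun e => by
    have h1 : canonEmb Z (S e) = biconjOp T e := DFunLike.congr_fun hST e
    rw [← norm_canonEmb, h1]
    exact (biconjOp T).le_of_opNorm_le ((norm_biconjOp_le T).trans hT.2) e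
  -- `S` is `T**` viewed as an operator into `Z`, so `R` is `T** V` restricted to `Z`; the identity
  -- factor only matches the shape of `comp_mem`.
  let R : Z →L[ℝ] Z := (ContinuousLinearMap.id ℝ Z ∘L S) ∘L (V ∘L canonEmb Z)
  have hR : R ∈ A.comp Z Z := A.comp_mem Z (Bidual Z) Z Z _ S _ hS
  have hRn : ‖R‖ ≤ L * (M + 1) := by
    refine R.opNorm_le_bound (by positivity) fun x => ?_
    have h1 := V.le_of_opNorm_le hVM (canonEmb Z x)
    rw [norm_canonEmb] at h1
    calc ‖S (V (canonEmb Z x))‖ ≤ L * ‖V (canonEmb Z x)‖ := S.le_of_opNorm_le hSn _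
      _ ≤ L * ((M + 1) * ‖x‖) := by gcongr
      _ = L * (M + 1) * ‖x‖ := by ring
  refine ⟨conjOp R, ⟨R, ⟨hR, hRn⟩, rfl⟩, fun f hf => ?_⟩
  -- That `V*` preserves `Z*` makes `w = V*(T* f)` an element of `Z*`, so `φ f` can be evaluated at
  -- it.
  obtain ⟨w, hw⟩ := hVw (conjOp T f)
  have hRw : conjOp R f = w := by
    ext x
    have h1 : canonEmb Z (S (V (canonEmb Z x))) f = V (canonEmb Z x) (conjOp T f) :=
      DFunLike.congr_fun (DFunLike.congr_fun hST (V (canonEmb Z x))) f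
    exact h1.trans (DFunLike.congr_fun hw (canonEmb Z x)).symm
  have hz' := hz ⟨f, hf⟩
  have e1 : φ f (conjOp R f) = f (T (z ⟨f, hf⟩)) := by
    rw [hRw]
    have h1 : φ f w = V (φ f) (conjOp T f) := DFunLike.congr_fun hw (φ f)
    rw [h1, ← hz']
    rfl
  have e2 : φ f f = f (z ⟨f, hf⟩) := by
    rw [← hVF (φ f) (hφ f hf) f (Submodule.subset_span hf), ← hz']
    rfl
  have h1 := hTz _ (Finset.mem_image_of_mem z (Finset.mem_univ ⟨f, hf⟩))
  have h2 := f.le_opNorm (T (z ⟨f, hf⟩) - z ⟨f, hf⟩)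
  have h3 : ‖f‖ < 1 + ∑ f ∈ s, ‖f‖ := by
    linarith [Finset.single_le_sum (f := fun g : StrongDual ℝ Z => ‖g‖)
      (fun y _ => norm_nonneg y) hf]
  rw [e1, e2, ← map_sub, ← Real.norm_eq_abs]
  calc ‖f (T (z ⟨f, hf⟩) - z ⟨f, hf⟩)‖ ≤ ‖f‖ * ‖T (z ⟨f, hf⟩) - z ⟨f, hf⟩‖ := h2
    _ ≤ ‖f‖ * (ε / (1 + ∑ f ∈ s, ‖f‖)) := by gcongr
    _ < (1 + ∑ f ∈ s, ‖f‖) * (ε / (1 + ∑ f ∈ s, ‖f‖)) :=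
        mul_lt_mul_of_pos_right h3 (div_pos hε hK)
    _ = ε := mul_div_cancel₀ _ hK.ne'

end Duality

theorem mainTheorem5 (A : OperatorIdeal.{u}) (hdd : A.EqDD) (hbi : A.BiconjIntoSpace)
    (X : Type u) [NormedAddCommGroup X] [NormedSpace ℝ X] [CompleteSpace X] :
    A.ConjBAP (LipFree.dualEquiv X) ↔
      (A.BAP (LipFree X) ∧ StronglyExtLocReflexive (LipFree X)) := by
  rw [A.conjBAP_iff_dualApprox]
  exact ⟨fun h => ⟨h.bap, h.stronglyExtLocReflexive hbi⟩, fun h => h.1.dualApprox hbi h.2⟩
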